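/- Let $\otimes$ be a quantale structure on the complete lattice $[0,1]$ which is either multiplication or the Łukasiewicz tensor $u\otimes v=\max(0,u+v-1)$, and let $\hom(u,-)$ be the right adjoint of $u\otimes-$. **Conventions.** $\mathrm{PosComp}$ is the category of partially ordered compact spaces (compact spaces with a partial order whose graph is closed) and monotone continuous maps. The Vietoris monad $\mathbb V=(V,m,e)$ on $\mathrm{PosComp}$ is given as follows: $VX$ is the set of closed upper subsets of $X$, ordered by $\supseteq$, with the topology generated by the sets $\{A\mid A\cap U\neq\varnothing\}$ ($U\subseteq X$ open lower) and $\{A\mid A\cap K=\varnothing\}$ ($K\subseteq X$ closed lower); $Vf(A)$ is the upper closure of $f(A)$; $e_X(x)=\{y\mid x\le y\}$ and $m_X(\mathcal A)=\bigcup\mathcal A$. The category $\mathrm{PosCompDist}$ (isomorphic to the Kleisli category of $\mathbb V$) has partially ordered compact spaces as objects; a morphism from $X$ to $Y$ is a relation $\varphi$ such that $x\mapsto\{y\mid x\mathrel{\varphi}y\}$ is a morphism $X\to VY$ in $\mathrm{PosComp}$; composition is relational composition, and the identity on $X$ is the order relation. A $[0,1]$-category is a set $A$ with a map $a:A\times A\to[0,1]$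 such that $1\le a(x,x)$ and $a(x,y)\otimes a(y,z)\le a(x,z)$; its natural order is $x\le y\iff 1\le a(x,y)$, and it is separated if this order is antisymmetric. A $[0,1]$-functor $f:(A,a)\to(B,b)$ is a map with $a(x,y)\le b(f(x),f(y))$. A weighted diagram in $A$ consists of a $[0,1]$-category $(D,d)$, a $[0,1]$-functor $h:D\to A$, and a map $\psi:D\to[0,1]$ with $d(x,y)\otimes\psi(y)\le\psi(x)$; an element $x_0\in A$ is a colimit of it if $a(x_0,x)=\bigwedge_{z\in D}\hom(\psi(z),a(h(z),x))$ for all $x\in A$. $A$ is finitely cocomplete if all weighted diagrams with finite $D$ have colimits; a $[0,1]$-functor is finitely cocontinuous if it preserves all of these. $\mathrm{LaxMnd}(\mathrm{FinSup}_{[0,1]})$ is the category whose objects are separated finitely cocomplete $[0,1]$-categories equipped with a commutative monoid structure, again written $\otimes$, whose unit is the top element and for which every $x\otimes-$ is a finitely cocontinuous $[0,1]$-functor; its morphisms are the finitely cocontinuous $[0,1]$-functors $f$ with $f(x\otimes y)\le f(x)\otimes f(y)$ for all $x,y$. The interval $[0,1]$ is an object of this category, with structure $\hom$ and multiplication $\otimes$.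 Let $\mathrm{PosComp}\overset{C}{\underset{G}{\rightleftarrows}}\mathrm{LaxMnd}(\mathrm{FinSup}_{[0,1]})^{\mathrm{op}}$ be the adjunction $C\dashv G$ induced by the dualising object $([0,1]^{\mathrm{op}},[0,1])$. Here $CX=\mathrm{PosComp}(X,[0,1]^{\mathrm{op}})$ with all operations pointwise and with $[0,1]$-category structure $(\psi,\psi')\mapsto\bigwedge_{x\in X}\hom(\psi(x),\psi'(x))$; $GA$ is the set of morphisms $A\to[0,1]$ in $\mathrm{LaxMnd}(\mathrm{FinSup}_{[0,1]})$ with the topology and the order that are initial with respect to all evaluation maps $GA\to[0,1]^{\mathrm{op}}$, $\Phi\mapsto\Phi(a)$; both functors act on morphisms by precomposition, and unit and counit are the evaluation maps. Let $j$ be the monad morphism from $\mathbb V$ to the monad induced by $C\dashv G$ with components $$j_X:VX\to GCX,\qquad A\mapsto\bigl(\psi\mapsto\sup_{x\in A}\psi(x)\bigr),$$ and let $C:\mathrm{PosCompDist}\to\mathrm{LaxMnd}(\mathrm{FinSup}_{[0,1]})^{\mathrm{op}}$ be the functor which sends $X$ to $CX$ and $\varphi:X\to Y$ to the morphism $$C\varphi:CY\to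 CX,\qquad \psi\mapsto\bigl(x\mapsto\sup_{x\mathrel{\varphi}y}\psi(y)\bigr)$$ (suprema are taken in $[0,1]$, so that $\sup\varnothing=0$). **Theorem.** The monad morphism $j$ is an isomorphism of monads. Consequently the functor $C:\mathrm{PosCompDist}\to\mathrm{LaxMnd}(\mathrm{FinSup}_{[0,1]})^{\mathrm{op}}$ is fully faithful. -/

import Mathlib

open CategoryTheory Topology

universe u v w

namespace PosCompDuality

/-! ### Continuous quantale structures on the unit interval -/

/-- A quantale structure `⊗` on the complete lattice `[0,1]` with neutral element `1` which is
continuous for the Euclidean topology, i.e. a continuous t-norm. -/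
structure ContTNorm where
  tens : unitInterval → unitInterval → unitInterval
  tens_assoc : ∀ a b c, tens (tens a b) c = tens a (tens b c)
  tens_comm : ∀ a b, tens a b = tens b a
  tens_one : ∀ a, tens a 1 = a
  tens_sSup : ∀ (a : unitInterval) (S : Set unitInterval), tens a (sSup S) = ⨆ b ∈ S, tens a b
  continuous_tens : Continuous fun p : unitInterval × unitInterval => tens p.1 p.2

namespace ContTNorm

variable (T : ContTNorm)

theorem tens_mono_right {a b c : unitInterval} (h : b ≤ c) : T.tens a b ≤ T.tens a c := by
  have h1 := T.tens_sSup a {b, c}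
  rw [sSup_pair, sup_eq_right.2 h] at h1
  rw [h1]
  exact le_iSup₂_of_le b (by simp) le_rfl

theorem tens_mono {a a' b b' : unitInterval} (h : a ≤ a') (h' : b ≤ b') :
    T.tens a b ≤ T.tens a' b' := by
  refine (T.tens_mono_right h').trans ?_
  rw [T.tens_comm a, T.tens_comm a']
  exact T.tens_mono_right h

theorem tens_iSup {ι : Sort*} (a : unitInterval) (f : ι → unitInterval) :
    T.tens a (⨆ i, f i) = ⨆ i, T.tens a (f i) := by
  rw [← sSup_range, T.tens_sSup]
  exact iSup_range

theorem iSup_tens {ι : Sort*} (a : unitInterval) (f : ι → unitInterval) :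
    T.tens (⨆ i, f i) a = ⨆ i, T.tens (f i) a := by
  rw [T.tens_comm, T.tens_iSup]
  simp only [T.tens_comm]

theorem one_tens (a : unitInterval) : T.tens 1 a = a := by rw [T.tens_comm, T.tens_one]

theorem tens_le_left (a b : unitInterval) : T.tens a b ≤ a :=
  (T.tens_mono_right unitInterval.le_one').trans_eq (T.tens_one a)

/-- The right adjoint `hom(u,-)` of `u ⊗ -`. -/
noncomputable def ihom (a c : unitInterval) : unitInterval := sSup {b | T.tens a b ≤ c}

theorem le_ihom {a b c : unitInterval} : b ≤ T.ihom a c ↔ T.tens a b ≤ c := by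
  constructor
  · intro h
    refine (T.tens_mono_right h).trans ?_
    rw [ihom, T.tens_sSup]
    exact iSup₂_le fun _ h => h
  · exact fun h => le_sSup h

theorem one_le_ihom {a c : unitInterval} : 1 ≤ T.ihom a c ↔ a ≤ c := by
  rw [le_ihom, tens_one]

theorem tens_ihom_le (a c : unitInterval) : T.tens a (T.ihom a c) ≤ c := T.le_ihom.1 le_rfl

theorem ihom_trans (a b c : unitInterval) :
    T.tens (T.ihom a b) (T.ihom b c) ≤ T.ihom a c := by
  rw [le_ihom, ← tens_assoc]
  exact (T.tens_mono (T.tens_ihom_le a b) le_rfl).trans (T.tens_ihom_le b c)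

end ContTNorm

theorem eq_iSup_of_continuous {f : unitInterval → unitInterval} (hf : Continuous f)
    (hm : Monotone f) (h0 : f 0 = 0) (S : Set unitInterval) : f (sSup S) = ⨆ b ∈ S, f b := by
  rw [hm.map_sSup_of_continuousAt hf.continuousAt h0, sSup_image]

/-- Multiplication on `[0,1]`. -/
noncomputable def mulTNorm : ContTNorm where
  tens a b := a * b
  tens_assoc := mul_assoc
  tens_comm := mul_comm
  tens_one := mul_one
  tens_sSup a S := eq_iSup_of_continuous (f := fun b => a * b) (by fun_prop)
    (fun _ _ h => mul_le_mul_right h a) (mul_zero a) S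
  continuous_tens := by fun_prop

/-- The Łukasiewicz tensor `u ⊙ v = max(0, u + v - 1)` on `[0,1]`. -/
noncomputable def lukTNorm : ContTNorm where
  tens a b := ⟨max 0 ((a : ℝ) + b - 1), le_max_left _ _,
    max_le zero_le_one (by linarith [a.2.2, b.2.2])⟩
  tens_assoc a b c := by
    have := a.2.1; have := a.2.2; have := b.2.1; have := b.2.2; have := c.2.1; have := c.2.2
    ext
    grind
  tens_comm a b := by ext; simp [add_comm]
  tens_one a := by
    ext
    have := a.2.1
    simpa using this
  tens_sSup a S := eq_iSup_of_continuous
    (f := fun b => ⟨max 0 ((a : ℝ) + b - 1), le_max_left _ _,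
      max_le zero_le_one (by linarith [a.2.2, b.2.2])⟩) (by fun_prop)
    (fun b c h => by
      have h' : (b : ℝ) ≤ c := h
      exact Subtype.coe_le_coe.1 (max_le_max le_rfl (by linarith)))
    (by
      ext
      have := a.2.2
      simpa using this) S
  continuous_tens := by fun_prop

/-! ### Categories enriched in `[0,1]` -/

/-- A `[0,1]`-category. -/
structure VCat (T : ContTNorm) where
  carrier : Type u
  a : carrier → carrier → unitInterval
  refl : ∀ x, 1 ≤ a x x
  trans : ∀ x y z, T.tens (a x y) (a y z) ≤ a x z

namespace VCat

variable {T : ContTNorm}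

/-- The natural order of a `[0,1]`-category. -/
def le (X : VCat.{u} T) (x y : X.carrier) : Prop := 1 ≤ X.a x y

/-- The natural order is antisymmetric. -/
def Separated (X : VCat.{u} T) : Prop := ∀ x y, X.le x y → X.le y x → x = y

/-- `[0,1]`-functors. -/
def IsFunctor (X : VCat.{u} T) (Y : VCat.{v} T) (f : X.carrier → Y.carrier) : Prop :=
  ∀ x y, X.a x y ≤ Y.a (f x) (f y)

/-- A distributor `ψ` from `A` to the one-point `[0,1]`-category `(1,k)`: a colimit weight. -/
def IsWeight (A : VCat.{u} T) (ψ : A.carrier → unitInterval) : Prop :=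
  ∀ x y, T.tens (A.a x y) (ψ y) ≤ ψ x

/-- `x₀` is a colimit in `X` of `h : A → X` weighted by `ψ`. -/
def IsColimit (A : VCat.{u} T) (X : VCat.{v} T) (h : A.carrier → X.carrier)
    (ψ : A.carrier → unitInterval) (x₀ : X.carrier) : Prop :=
  ∀ x, X.a x₀ x = ⨅ z, T.ihom (ψ z) (X.a (h z) x)

/-- Every weighted colimit diagram of finite shape has a colimit. (A finite shape may be taken
in the lowest universe.) -/
def FinitelyCocomplete (X : VCat.{u} T) : Prop :=
  ∀ A : VCat.{0} T, Finite A.carrier → ∀ (h : A.carrier → X.carrier) (ψ : A.carrier → unitInterval),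
    IsFunctor A X h → IsWeight A ψ → ∃ x₀, IsColimit A X h ψ x₀

/-- The map `f` preserves colimits of weighted colimit diagrams of finite shape. -/
def PreservesFiniteColimits (X : VCat.{u} T) (Y : VCat.{v} T) (f : X.carrier → Y.carrier) : Prop :=
  ∀ A : VCat.{0} T, Finite A.carrier → ∀ (h : A.carrier → X.carrier) (ψ : A.carrier → unitInterval),
    IsFunctor A X h → IsWeight A ψ → ∀ x₀, IsColimit A X h ψ x₀ →
      IsColimit A Y (fun z => f (h z)) ψ (f x₀)

/-- Finitely cocontinuous `[0,1]`-functors. -/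
structure IsFinCocont (X : VCat.{u} T) (Y : VCat.{v} T) (f : X.carrier → Y.carrier) : Prop where
  functor : IsFunctor X Y f
  cocont : PreservesFiniteColimits X Y f

theorem IsColimit.unique {A : VCat.{u} T} {X : VCat.{v} T} (hX : X.Separated)
    {h : A.carrier → X.carrier} {ψ : A.carrier → unitInterval} {x y : X.carrier}
    (hx : IsColimit A X h ψ x) (hy : IsColimit A X h ψ y) : x = y :=
  hX _ _ ((X.refl y).trans_eq ((hy y).trans (hx y).symm))
    ((X.refl x).trans_eq ((hx x).trans (hy x).symm))

theorem IsFinCocont.comp {X : VCat.{u} T} {Y : VCat.{v} T} {Z : VCat.{w} T}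
    {f : X.carrier → Y.carrier} {g : Y.carrier → Z.carrier}
    (hg : IsFinCocont Y Z g) (hf : IsFinCocont X Y f) : IsFinCocont X Z fun x => g (f x) where
  functor x y := (hf.functor x y).trans (hg.functor _ _)
  cocont A hA h ψ hh hψ x₀ hx₀ := hg.cocont A hA _ ψ
    (fun x y => (hh x y).trans (hf.functor _ _)) hψ _ (hf.cocont A hA h ψ hh hψ x₀ hx₀)

theorem IsFinCocont.id (X : VCat.{u} T) : IsFinCocont X X fun x => x where
  functor _ _ := le_rfl
  cocont _ _ _ _ _ _ _ h := h

end VCat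

/-- Separated finitely cocomplete `[0,1]`-categories. -/
structure FinSup (T : ContTNorm) extends VCat.{u} T where
  separated : toVCat.Separated
  cocomplete : toVCat.FinitelyCocomplete

/-- Commutative monoids in `FinSup`: the unit is the top element and multiplication is a finitely
cocontinuous `[0,1]`-functor in each variable. -/
structure LaxMnd (T : ContTNorm) extends FinSup.{u} T where
  mul : carrier → carrier → carrier
  one : carrier
  mul_assoc : ∀ x y z, mul (mul x y) z = mul x (mul y z)
  mul_comm : ∀ x y, mul x y = mul y x
  mul_one : ∀ x, mul x one = x
  le_one : ∀ x, toVCat.le x one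
  mul_cocont : ∀ x, VCat.IsFinCocont toVCat toVCat (mul x)

namespace LaxMnd

variable {T : ContTNorm}

/-- Lax monoid homomorphisms: finitely cocontinuous `[0,1]`-functors `f` with
`f (x ⊗ y) ≤ f x ⊗ f y`. -/
@[ext]
structure Hom (A : LaxMnd.{u} T) (B : LaxMnd.{v} T) where
  toFun : A.carrier → B.carrier
  isFinCocont : VCat.IsFinCocont A.toVCat B.toVCat toFun
  lax : ∀ x y, B.le (toFun (A.mul x y)) (B.mul (toFun x) (toFun y))

theorem le_trans' (X : VCat.{u} T) {x y z : X.carrier} (h : X.le x y) (h' : X.le y z) :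
    X.le x z := by
  refine le_trans ?_ (X.trans x y z)
  rw [← T.tens_one 1]
  exact T.tens_mono h h'

/-- Composition of lax monoid homomorphisms. -/
def Hom.comp {A : LaxMnd.{u} T} {B : LaxMnd.{v} T} {C : LaxMnd.{w} T} (f : Hom A B) (g : Hom B C) :
    Hom A C where
  toFun x := g.toFun (f.toFun x)
  isFinCocont := g.isFinCocont.comp f.isFinCocont
  lax x y := le_trans' _ ((f.lax x y).trans (g.isFinCocont.functor _ _)) (g.lax _ _)

/-- The category `LaxMnd(FinSup)` of commutative monoids and lax monoid homomorphisms. -/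
instance : Category (LaxMnd.{u} T) where
  Hom A B := Hom A B
  id A := { toFun := fun x => x, isFinCocont := .id _, lax := fun _ _ => A.refl _ }
  comp f g := Hom.comp f g

end LaxMnd

/-! ### The unit interval as a commutative monoid in `FinSup` -/

section UnitInterval

variable (T : ContTNorm)

/-- The `[0,1]`-category `([0,1], hom)`. -/
noncomputable def unitVCat : VCat.{0} T where
  carrier := unitInterval
  a := T.ihom
  refl _ := T.one_le_ihom.2 le_rfl
  trans := T.ihom_trans

variable {T}

theorem ContTNorm.ihom_iSup_tens {ι : Type u} (f g : ι → unitInterval) (x : unitInterval) :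
    T.ihom (⨆ z, T.tens (f z) (g z)) x = ⨅ z, T.ihom (g z) (T.ihom (f z) x) := by
  refine eq_of_forall_le_iff fun c => ?_
  rw [T.le_ihom, T.iSup_tens, iSup_le_iff, le_iInf_iff]
  refine forall_congr' fun z => ?_
  rw [T.le_ihom, T.le_ihom, T.tens_assoc]

theorem ContTNorm.tens_iSup_tens {ι : Type u} (u : unitInterval) (f g : ι → unitInterval) :
    T.tens u (⨆ z, T.tens (f z) (g z)) = ⨆ z, T.tens (T.tens u (f z)) (g z) := by
  rw [T.tens_iSup]
  simp only [T.tens_assoc]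

theorem unitVCat_separated : (unitVCat T).Separated := fun _ _ h h' =>
  le_antisymm (α := unitInterval) (T.one_le_ihom.1 h) (T.one_le_ihom.1 h')

theorem isColimit_unitVCat_iff {A : VCat.{u} T} {h ψ : A.carrier → unitInterval}
    {x : unitInterval} :
    VCat.IsColimit A (unitVCat T) h ψ x ↔ x = ⨆ z, T.tens (h z) (ψ z) := by
  have key : VCat.IsColimit A (unitVCat T) h ψ (iSup (α := unitInterval) fun z => T.tens (h z) (ψ z)) :=
    fun x => T.ihom_iSup_tens h ψ x
  exact ⟨fun hx => hx.unique unitVCat_separated key, fun hx => hx ▸ key⟩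

theorem ContTNorm.ihom_le_ihom_tens (u a b : unitInterval) :
    T.ihom a b ≤ T.ihom (T.tens u a) (T.tens u b) := by
  rw [T.le_ihom, T.tens_assoc]
  exact T.tens_mono_right (T.tens_ihom_le a b)

variable (T)

/-- `[0,1]` as a commutative monoid in `FinSup`, with multiplication `⊗`. -/
noncomputable def unitMnd : LaxMnd.{0} T where
  toVCat := unitVCat T
  separated := unitVCat_separated
  cocomplete _ _ _ _ _ _ := ⟨_, isColimit_unitVCat_iff.2 rfl⟩
  mul := T.tens
  one := (1 : unitInterval)
  mul_assoc := T.tens_assoc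
  mul_comm := T.tens_comm
  mul_one := T.tens_one
  le_one _ := T.one_le_ihom.2 unitInterval.le_one'
  mul_cocont u :=
    { functor := fun a b => ContTNorm.ihom_le_ihom_tens u a b
      cocont := fun A _ h ψ _ _ x₀ hx => by
        exact isColimit_unitVCat_iff.2 ((congrArg (T.tens u) (isColimit_unitVCat_iff.1 hx)).trans
          (ContTNorm.tens_iSup_tens u h ψ)) }

end UnitInterval

/-! ### Partially ordered compact spaces -/

/-- Partially ordered compact spaces: compact spaces with a partial order `≤` whose graph is
closed. -/
structure PosComp where
  carrier : Type u
  [top : TopologicalSpace carrier]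
  [order : PartialOrder carrier]
  [compact : CompactSpace carrier]
  [closed : OrderClosedTopology carrier]

namespace PosComp

attribute [instance] PosComp.top PosComp.order PosComp.compact PosComp.closed

/-- Monotone continuous maps. -/
@[ext]
structure Hom (X : PosComp.{u}) (Y : PosComp.{v}) where
  toFun : X.carrier → Y.carrier
  monotone : Monotone toFun
  continuous : Continuous toFun

/-- Composition of monotone continuous maps. -/
def Hom.comp {X : PosComp.{u}} {Y : PosComp.{v}} {Z : PosComp.{w}} (f : Hom X Y) (g : Hom Y Z) :
    Hom X Z where
  toFun x := g.toFun (f.toFun x)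
  monotone := g.monotone.comp f.monotone
  continuous := g.continuous.comp f.continuous

/-- The category `PosComp`. -/
instance : Category PosComp.{u} where
  Hom X Y := Hom X Y
  id X := { toFun := fun x => x, monotone := monotone_id, continuous := continuous_id }
  comp f g := Hom.comp f g

/-- The partially ordered compact space `[0,1]ᵒᵖ`. -/
abbrev unitOp : PosComp.{0} where
  carrier := unitIntervalᵒᵈ

end PosComp

/-! ### The functor `C` -/

/-- The underlying set of `CX`: monotone continuous maps `X → [0,1]ᵒᵖ`. -/
abbrev CSet (X : PosComp.{u}) : Type u := PosComp.Hom X PosComp.unitOp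

namespace CSet

variable {T : ContTNorm} {X : PosComp.{u}}

/-- The value of `ψ : X → [0,1]ᵒᵖ` at `x` as an element of `[0,1]`. -/
def val (ψ : CSet X) (x : X.carrier) : unitInterval := OrderDual.ofDual (ψ.toFun x)

theorem val_antitone (ψ : CSet X) : Antitone ψ.val := fun _ _ h => ψ.monotone h

theorem val_continuous (ψ : CSet X) : Continuous ψ.val := ψ.continuous

theorem ext_val {ψ φ : CSet X} (h : ∀ x, ψ.val x = φ.val x) : ψ = φ := PosComp.Hom.ext (funext h)

/-- An antitone continuous map `X → [0,1]` as an element of `CX`. -/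
def mk' (f : X.carrier → unitInterval) (hf : Antitone f) (hc : Continuous f) : CSet X where
  toFun x := OrderDual.toDual (f x)
  monotone := fun _ _ h => hf h
  continuous := hc

@[simp] theorem mk'_val (f : X.carrier → unitInterval) (hf : Antitone f) (hc : Continuous f) :
    (mk' f hf hc).val = f := rfl

/-- Pointwise tensor. -/
def mul (T : ContTNorm) (ψ φ : CSet X) : CSet X :=
  mk' (fun x => T.tens (ψ.val x) (φ.val x))
    (fun _ _ h => T.tens_mono (ψ.val_antitone h) (φ.val_antitone h))
    (T.continuous_tens.comp (ψ.val_continuous.prodMk φ.val_continuous))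

/-- The constant function `1`. -/
def one : CSet X := mk' (fun _ => 1) (fun _ _ _ => le_rfl) continuous_const

/-- Pointwise finite weighted suprema. -/
noncomputable def supTens (T : ContTNorm) {ι : Type} [Finite ι] (h : ι → CSet X)
    (ψ : ι → unitInterval) : CSet X :=
  mk' (fun x => ⨆ z, T.tens ((h z).val x) (ψ z))
    (fun _ _ hxy => iSup_mono fun z => T.tens_mono ((h z).val_antitone hxy) le_rfl)
    (by
      cases nonempty_fintype ι
      simp only [← Finset.sup_univ_eq_iSup]
      refine Continuous.finset_sup_apply fun z _ => ?_
      exact T.continuous_tens.comp ((h z).val_continuous.prodMk continuous_const))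

end CSet

section CObj

variable (T : ContTNorm) (X : PosComp.{u})

/-- The `[0,1]`-category `CX`, with the structure of a subcategory of the power `[0,1]^X`. -/
noncomputable def CVCat : VCat.{u} T where
  carrier := CSet X
  a ψ φ := ⨅ x, T.ihom (ψ.val x) (φ.val x)
  refl _ := le_iInf fun _ => T.one_le_ihom.2 le_rfl
  trans _ φ _ := le_iInf fun x =>
    (T.tens_mono (iInf_le _ x) (iInf_le _ x)).trans (T.ihom_trans _ (φ.val x) _)

variable {T X}

theorem CVCat_le_iff {ψ φ : CSet X} : (CVCat T X).le ψ φ ↔ ∀ x, ψ.val x ≤ φ.val x := by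
  simp only [VCat.le, CVCat, le_iInf_iff, T.one_le_ihom]

theorem CVCat_separated : (CVCat T X).Separated := fun _ _ h h' =>
  CSet.ext_val fun x => le_antisymm (CVCat_le_iff.1 h x) (CVCat_le_iff.1 h' x)

theorem isColimit_CVCat_iff {A : VCat.{0} T} [Finite A.carrier] {h : A.carrier → CSet X}
    {ψ : A.carrier → unitInterval} {χ : CSet X} :
    VCat.IsColimit A (CVCat T X) h ψ χ ↔ ∀ x, χ.val x = ⨆ z, T.tens ((h z).val x) (ψ z) := by
  have key : VCat.IsColimit A (CVCat T X) h ψ (CSet.supTens T h ψ) := by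
    intro φ
    change ⨅ x, T.ihom (⨆ z, T.tens ((h z).val x) (ψ z)) (φ.val x) =
      ⨅ z, T.ihom (ψ z) (⨅ x, T.ihom ((h z).val x) (φ.val x))
    simp only [T.ihom_iSup_tens]
    rw [iInf_comm]
    congr 1
    ext1 z
    refine eq_of_forall_le_iff fun c => ?_
    simp only [T.le_ihom, le_iInf_iff]
  constructor
  · intro hχ x
    rw [hχ.unique CVCat_separated key]
    rfl
  · intro hχ
    rwa [show χ = CSet.supTens T h ψ from CSet.ext_val hχ]

variable (T X)

/-- `CX` as a commutative monoid in `FinSup`, with pointwise operations. -/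
noncomputable def CObj : LaxMnd.{u} T where
  toVCat := CVCat T X
  separated := CVCat_separated
  cocomplete A _ h ψ _ _ := ⟨CSet.supTens T h ψ, isColimit_CVCat_iff.2 fun _ => rfl⟩
  mul := CSet.mul T
  one := CSet.one
  mul_assoc _ _ _ := CSet.ext_val fun _ => T.tens_assoc _ _ _
  mul_comm _ _ := CSet.ext_val fun _ => T.tens_comm _ _
  mul_one _ := CSet.ext_val fun _ => T.tens_one _
  le_one _ := CVCat_le_iff.2 fun _ => unitInterval.le_one'
  mul_cocont φ :=
    { functor := fun _ _ => le_iInf fun x =>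
        (iInf_le _ x).trans (ContTNorm.ihom_le_ihom_tens (φ.val x) _ _)
      cocont := fun A _ h ψ _ _ χ hχ => by
        refine isColimit_CVCat_iff.2 fun x => ?_
        change T.tens (φ.val x) (χ.val x) = ⨆ z, T.tens (T.tens (φ.val x) ((h z).val x)) (ψ z)
        rw [isColimit_CVCat_iff.1 hχ, ContTNorm.tens_iSup_tens] }

end CObj

/-- Precomposition with `f : X → Y`, as a morphism `CY → CX`. -/
noncomputable def CMap (T : ContTNorm) {X : PosComp.{u}} {Y : PosComp.{v}} (f : PosComp.Hom X Y) :
    LaxMnd.Hom (CObj T Y) (CObj T X) where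
  toFun ψ := PosComp.Hom.comp f ψ
  isFinCocont :=
    { functor := fun _ _ => le_iInf fun x => iInf_le _ (f.toFun x)
      cocont := fun _ _ _ _ _ _ _ hχ => by
        refine isColimit_CVCat_iff.2 fun x => ?_
        exact isColimit_CVCat_iff.1 hχ (f.toFun x) }
  lax _ _ := CVCat_le_iff.2 fun _ => le_rfl

/-- The functor `C : PosComp → LaxMnd(FinSup)ᵒᵖ`. -/
noncomputable def C (T : ContTNorm) : PosComp.{u} ⥤ (LaxMnd.{u} T)ᵒᵖ where
  obj X := Opposite.op (CObj T X)
  map f := Quiver.Hom.op (CMap T f)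

/-! ### The functor `G` -/

/-- The underlying set of `GA`: morphisms `A → [0,1]`. -/
def GSet {T : ContTNorm} (A : LaxMnd.{u} T) : Type u := LaxMnd.Hom A (unitMnd T)

namespace GSet

variable {T : ContTNorm} {A : LaxMnd.{u} T}

/-- Evaluation of `Φ : A → [0,1]`. -/
def ev (a : A.carrier) (Φ : GSet A) : unitInterval := Φ.toFun a

theorem ext_ev {Φ Ψ : GSet A} (h : ∀ a, Φ.ev a = Ψ.ev a) : Φ = Ψ :=
  LaxMnd.Hom.ext (funext h)

/-- `GA` has the order for which the evaluation maps to `[0,1]ᵒᵖ` are initial. -/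
instance : PartialOrder (GSet A) where
  le Φ Ψ := ∀ a, OrderDual.toDual (Φ.ev a) ≤ OrderDual.toDual (Ψ.ev a)
  le_refl _ _ := le_rfl
  le_trans _ _ _ h h' a := (h a).trans (h' a)
  le_antisymm _ _ h h' := ext_ev fun a => le_antisymm (h' a) (h a)

/-- `GA` has the initial topology with respect to all evaluation maps. -/
instance : TopologicalSpace (GSet A) :=
  ⨅ a : A.carrier, TopologicalSpace.induced (ev a) inferInstance

theorem isInducing_ev : IsInducing (fun (Φ : GSet A) (a : A.carrier) => Φ.ev a) :=
  ⟨(induced_to_pi (fun (Φ : GSet A) (a : A.carrier) => Φ.ev a)).symm⟩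

theorem continuous_ev (a : A.carrier) : Continuous (ev a : GSet A → unitInterval) :=
  (continuous_apply a).comp isInducing_ev.continuous

theorem continuous_iff {X : Type v} [TopologicalSpace X] {f : X → GSet A} :
    Continuous f ↔ ∀ a, Continuous fun x => (f x).ev a := by
  rw [isInducing_ev.continuous_iff, continuous_pi_iff]
  rfl

theorem isClosed_range_ev :
    IsClosed (Set.range fun (Φ : GSet A) (a : A.carrier) => Φ.ev a) := by
  have hr : (Set.range fun (Φ : GSet A) (a : A.carrier) => Φ.ev a) =
      {f : A.carrier → unitInterval | (∀ x y, T.tens (f x) (A.a x y) ≤ f y) ∧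
        (∀ B : VCat.{0} T, Finite B.carrier → ∀ (h : B.carrier → A.carrier)
          (ψ : B.carrier → unitInterval), VCat.IsFunctor B A.toVCat h → VCat.IsWeight B ψ →
          ∀ x₀, VCat.IsColimit B A.toVCat h ψ x₀ → f x₀ = ⨆ z, T.tens (f (h z)) (ψ z)) ∧
        ∀ x y, f (A.mul x y) ≤ T.tens (f x) (f y)} := by
    ext f
    constructor
    · rintro ⟨Φ, rfl⟩
      refine ⟨fun x y => T.le_ihom.1 (Φ.isFinCocont.functor x y), ?_,
        fun x y => T.one_le_ihom.1 (Φ.lax x y)⟩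
      intro B hB h ψ hh hψ x₀ hx
      exact isColimit_unitVCat_iff.1 (Φ.isFinCocont.cocont B hB h ψ hh hψ x₀ hx)
    · rintro ⟨h1, h2, h3⟩
      exact ⟨{ toFun := f
               isFinCocont :=
                ⟨fun x y => T.le_ihom.2 (h1 x y), fun B hB h ψ hh hψ x₀ hx =>
                  isColimit_unitVCat_iff.2 (h2 B hB h ψ hh hψ x₀ hx)⟩
               lax := fun x y => T.one_le_ihom.2 (h3 x y) }, rfl⟩
  have hT : ∀ {Z : Type u} [TopologicalSpace Z] {f g : Z → unitInterval}, Continuous f →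
      Continuous g → Continuous fun z => T.tens (f z) (g z) := fun hf hg =>
    T.continuous_tens.comp (hf.prodMk hg)
  rw [hr]
  simp only [Set.ofPred_and, Set.ofPred_forall]
  refine IsClosed.inter ?_ (IsClosed.inter ?_ ?_)
  · exact isClosed_iInter fun x => isClosed_iInter fun y => isClosed_le
      (hT (continuous_apply x) continuous_const) (continuous_apply y)
  · refine isClosed_iInter fun B => isClosed_iInter fun hB => isClosed_iInter fun h =>
      isClosed_iInter fun ψ => isClosed_iInter fun _ => isClosed_iInter fun _ =>
      isClosed_iInter fun x₀ => isClosed_iInter fun _ => isClosed_eq (continuous_apply x₀) ?_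
    cases nonempty_fintype B.carrier
    simp only [← Finset.sup_univ_eq_iSup]
    exact Continuous.finset_sup_apply fun z _ => hT (continuous_apply _) continuous_const
  · exact isClosed_iInter fun x => isClosed_iInter fun y => isClosed_le (continuous_apply _)
      (hT (continuous_apply x) (continuous_apply y))

instance : CompactSpace (GSet A) :=
  IsClosedEmbedding.compactSpace (f := fun (Φ : GSet A) (a : A.carrier) => Φ.ev a)
    ⟨⟨isInducing_ev, fun _ _ h => ext_ev fun a => congrFun h a⟩, isClosed_range_ev⟩

instance : OrderClosedTopology (GSet A) where
  isClosed_le' := by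
    have : {p : GSet A × GSet A | p.1 ≤ p.2} = ⋂ a, {p | p.2.ev a ≤ p.1.ev a} := by
      ext p
      simp only [Set.mem_iInter]
      rfl
    rw [this]
    exact isClosed_iInter fun a => isClosed_le ((continuous_ev a).comp continuous_snd)
      ((continuous_ev a).comp continuous_fst)

end GSet

/-- The partially ordered compact space `GA`. -/
abbrev GObj {T : ContTNorm} (A : LaxMnd.{u} T) : PosComp.{u} where
  carrier := GSet A

/-- Precomposition with `f : A → B`, as a morphism `GB → GA`. -/
noncomputable def GMap {T : ContTNorm} {A : LaxMnd.{u} T} {B : LaxMnd.{v} T} (f : LaxMnd.Hom A B) :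
    PosComp.Hom (GObj B) (GObj A) where
  toFun Φ := LaxMnd.Hom.comp f Φ
  monotone _ _ h a := h (f.toFun a)
  continuous := GSet.continuous_iff.2 fun a => GSet.continuous_ev (f.toFun a)

/-- The functor `G : LaxMnd(FinSup)ᵒᵖ → PosComp`. -/
noncomputable def G (T : ContTNorm) : (LaxMnd.{u} T)ᵒᵖ ⥤ PosComp.{u} where
  obj A := GObj A.unop
  map f := GMap f.unop

/-! ### The adjunction `C ⊣ G` -/

/-- The unit `x ↦ ev_x`. -/
noncomputable def unitEv (T : ContTNorm) (X : PosComp.{u}) : PosComp.Hom X (GObj (CObj T X)) where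
  toFun x :=
    { toFun := fun ψ : CSet X => ψ.val x
      isFinCocont :=
        ⟨fun _ _ => iInf_le _ x, fun _ _ _ _ _ _ _ hχ =>
          isColimit_unitVCat_iff.2 (isColimit_CVCat_iff.1 hχ x)⟩
      lax := fun _ _ => T.one_le_ihom.2 le_rfl }
  monotone _ _ h ψ := ψ.val_antitone h
  continuous := GSet.continuous_iff.2 fun ψ => CSet.val_continuous ψ

/-- The counit `a ↦ ev_a`. -/
noncomputable def counitEv {T : ContTNorm} (A : LaxMnd.{u} T) :
    LaxMnd.Hom A (CObj T (GObj A)) where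
  toFun a := CSet.mk' (GSet.ev a) (fun _ _ h => h a) (GSet.continuous_ev a)
  isFinCocont :=
    ⟨fun a b => le_iInf fun Φ => Φ.isFinCocont.functor a b, fun B hB h ψ hh hψ x₀ hx =>
      isColimit_CVCat_iff.2 fun Φ =>
        isColimit_unitVCat_iff.1 (Φ.isFinCocont.cocont B hB h ψ hh hψ x₀ hx)⟩
  lax a b := CVCat_le_iff.2 fun Φ => T.one_le_ihom.1 (Φ.lax a b)

/-- The adjunction `C ⊣ G` induced by the dualising object `([0,1]ᵒᵖ, [0,1])`. -/
noncomputable def adj (T : ContTNorm) : C.{u} T ⊣ G.{u} T :=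
  Adjunction.mkOfUnitCounit
    { unit := { app := fun X => unitEv T X }
      counit := { app := fun A => Quiver.Hom.op (counitEv A.unop) } }

/-! ### The Vietoris monad on `PosComp` -/

section Nachbin

variable {α : Type u} [TopologicalSpace α] [PartialOrder α] [CompactSpace α]
  [OrderClosedTopology α]

theorem isClosed_up {A : Set α} (hA : IsClosed A) : IsClosed {y | ∃ x ∈ A, x ≤ y} := by
  have h : IsCompact (Prod.snd '' ({p : α × α | p.1 ≤ p.2} ∩ Prod.fst ⁻¹' A)) :=
    ((isClosed_le continuous_fst continuous_snd).inter
      (hA.preimage continuous_fst)).isCompact.image continuous_snd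
  convert h.isClosed using 1
  ext y
  simp [and_comm]

theorem isClosed_down {A : Set α} (hA : IsClosed A) : IsClosed {y | ∃ x ∈ A, y ≤ x} := by
  have h : IsCompact (Prod.fst '' ({p : α × α | p.1 ≤ p.2} ∩ Prod.snd ⁻¹' A)) :=
    ((isClosed_le continuous_fst continuous_snd).inter
      (hA.preimage continuous_snd)).isCompact.image continuous_fst
  convert h.isClosed using 1
  ext y
  simp [and_comm]

/-- A point outside a closed upper set is separated from it by an open lower set inside a closed
lower set. -/
theorem exists_lower_nhd {A : Set α} (hA : IsClosed A) (hA' : IsUpperSet A) {b : α} (hb : b ∉ A) :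
    ∃ U K : Set α, IsOpen U ∧ IsLowerSet U ∧ IsClosed K ∧ IsLowerSet K ∧ b ∈ U ∧ U ⊆ K ∧
      A ∩ K = ∅ := by
  obtain ⟨P, Q, hP, hQ, hAP, hBQ, hPQ⟩ := normal_separation hA (isClosed_Iic (a := b))
    (Set.disjoint_left.2 fun x hx hxb => hb (hA' hxb hx))
  refine ⟨{y | ∃ x ∈ Qᶜ, x ≤ y}ᶜ, {y | ∃ x ∈ Pᶜ, y ≤ x}, (isClosed_up hQ.isClosed_compl).isOpen_compl,
    ?_, isClosed_down hP.isClosed_compl, ?_, ?_, ?_, ?_⟩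
  · rintro x y hyx hx ⟨z, hz, hzy⟩
    exact hx ⟨z, hz, hzy.trans hyx⟩
  · rintro x y hyx ⟨z, hz, hxz⟩
    exact ⟨z, hz, hyx.trans hxz⟩
  · rintro ⟨z, hz, hzb⟩
    exact hz (hBQ hzb)
  · intro x hx
    have hxQ : x ∈ Q := by
      by_contra h
      exact hx ⟨x, h, le_rfl⟩
    exact ⟨x, fun hxP => Set.disjoint_left.1 hPQ hxP hxQ, le_rfl⟩
  · rw [Set.eq_empty_iff_forall_notMem]
    rintro x ⟨hxA, z, hz, hxz⟩
    exact hz (hAP (hA' hxz hxA))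

end Nachbin

/-- The underlying set of `VX`: closed upper subsets of `X`. -/
@[ext]
structure VSet (X : PosComp.{u}) where
  set : Set X.carrier
  isClosed : IsClosed set
  isUpperSet : IsUpperSet set

namespace VSet

variable {X : PosComp.{u}}

/-- `VX` is ordered by containment `⊇`. -/
instance : PartialOrder (VSet X) where
  le A B := B.set ⊆ A.set
  le_refl _ := subset_rfl
  le_trans _ _ _ h h' := h'.trans h
  le_antisymm _ _ h h' := VSet.ext (h'.antisymm h)

/-- The closed upper sets meeting `U`. -/
def hit (U : Set X.carrier) : Set (VSet X) := {A | (A.set ∩ U).Nonempty}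

/-- The closed upper sets disjoint from `K`. -/
def miss (K : Set X.carrier) : Set (VSet X) := {A | A.set ∩ K = ∅}

/-- The topology of `VX` is generated by the sets `hit U` with `U` open lower and `miss K` with
`K` closed lower. -/
instance : TopologicalSpace (VSet X) :=
  TopologicalSpace.generateFrom
    ({S | ∃ U : Set X.carrier, IsOpen U ∧ IsLowerSet U ∧ S = hit U} ∪
      {S | ∃ K : Set X.carrier, IsClosed K ∧ IsLowerSet K ∧ S = miss K})

theorem isOpen_hit {U : Set X.carrier} (hU : IsOpen U) (hU' : IsLowerSet U) :
    IsOpen (hit U) :=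
  TopologicalSpace.isOpen_generateFrom_of_mem (Or.inl ⟨U, hU, hU', rfl⟩)

theorem isOpen_miss {K : Set X.carrier} (hK : IsClosed K) (hK' : IsLowerSet K) :
    IsOpen (miss K) :=
  TopologicalSpace.isOpen_generateFrom_of_mem (Or.inr ⟨K, hK, hK', rfl⟩)

theorem continuous_iff {Z : Type v} [TopologicalSpace Z] {f : Z → VSet X} :
    Continuous f ↔ (∀ U, IsOpen U → IsLowerSet U → IsOpen (f ⁻¹' hit U)) ∧
      ∀ K, IsClosed K → IsLowerSet K → IsOpen (f ⁻¹' miss K) := by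
  rw [continuous_generateFrom_iff]
  constructor
  · exact fun h => ⟨fun U hU hU' => h _ (Or.inl ⟨U, hU, hU', rfl⟩),
      fun K hK hK' => h _ (Or.inr ⟨K, hK, hK', rfl⟩)⟩
  · rintro ⟨h1, h2⟩ S (⟨U, hU, hU', rfl⟩ | ⟨K, hK, hK', rfl⟩)
    · exact h1 U hU hU'
    · exact h2 K hK hK'

theorem compl_hit (U : Set X.carrier) : (hit U)ᶜ = miss U := by
  ext A
  exact Set.not_nonempty_iff_eq_empty

theorem compl_miss (U : Set X.carrier) : (miss U)ᶜ = hit U := by rw [← compl_hit, compl_compl]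

theorem isLowerSet_hit (U : Set X.carrier) : IsLowerSet (hit U) := by
  intro A B (hBA : A.set ⊆ B.set) hA
  exact hA.mono (Set.inter_subset_inter_left _ hBA)

instance : CompactSpace (VSet X) := by
  rw [← isCompact_univ_iff, isCompact_iff_ultrafilter_le_nhds]
  intro F _
  let W : Set (Set X.carrier) := {U | IsOpen U ∧ IsLowerSet U ∧ hit U ∉ F}
  refine ⟨⟨(⋃₀ W)ᶜ, (isOpen_sUnion fun U hU => hU.1).isClosed_compl,
    (isLowerSet_sUnion fun U hU => hU.2.1).compl⟩, Set.mem_univ _, ?_⟩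
  have key := (TopologicalSpace.tendsto_nhds_generateFrom_iff (m := id) (f := (F : Filter (VSet X)))
    (g := ({S | ∃ U : Set X.carrier, IsOpen U ∧ IsLowerSet U ∧ S = hit U} ∪
      {S | ∃ K : Set X.carrier, IsClosed K ∧ IsLowerSet K ∧ S = miss K}))
    (b := ⟨(⋃₀ W)ᶜ, (isOpen_sUnion fun U hU => hU.1).isClosed_compl,
      (isLowerSet_sUnion fun U hU => hU.2.1).compl⟩)).2
  refine key ?_
  rintro S (⟨U, hU, hU', rfl⟩ | ⟨K, hK, hK', rfl⟩) hS
  · by_contra hF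
    obtain ⟨x, hx, hxU⟩ := hS
    exact hx ⟨U, ⟨hU, hU', hF⟩, hxU⟩
  · have hKW : K ⊆ ⋃₀ W := by
      intro x hx
      by_contra hxW
      exact (Set.eq_empty_iff_forall_notMem.1 hS x) ⟨hxW, hx⟩
    obtain ⟨t, htW, ht, hKt⟩ := hK.isCompact.elim_finite_subcover_image (b := W) (c := id)
      (fun U hU => hU.1) (by rwa [Set.sUnion_eq_biUnion] at hKW)
    have h1 : ⋂ U ∈ t, miss U ∈ (F : Filter (VSet X)) := by
      rw [Filter.biInter_mem ht]
      intro U hU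
      rw [← compl_hit]
      exact Ultrafilter.compl_mem_iff_notMem.2 (htW hU).2.2
    refine Filter.mem_of_superset h1 fun A hA => ?_
    refine Set.eq_empty_iff_forall_notMem.2 fun x hx => ?_
    obtain ⟨U, hU, hxU⟩ := Set.mem_iUnion₂.1 (hKt hx.2)
    exact Set.eq_empty_iff_forall_notMem.1 (Set.mem_iInter₂.1 hA U hU) x ⟨hx.1, hxU⟩

instance : OrderClosedTopology (VSet X) where
  isClosed_le' := by
    rw [← isOpen_compl_iff, isOpen_prod_iff]
    intro A B hAB
    obtain ⟨b, hbB, hbA⟩ := Set.not_subset.1 hAB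
    obtain ⟨U, K, hU, hU', hK, hK', hbU, hUK, hAK⟩ := exists_lower_nhd A.isClosed A.isUpperSet hbA
    refine ⟨miss K, hit U, isOpen_miss hK hK', isOpen_hit hU hU', hAK, ⟨b, hbB, hbU⟩, ?_⟩
    rintro ⟨A', B'⟩ ⟨hA', x, hxB, hxU⟩ (hle : B'.set ⊆ A'.set)
    exact Set.eq_empty_iff_forall_notMem.1 hA' x ⟨hle hxB, hUK hxU⟩

end VSet

/-- The partially ordered compact space `VX`. -/
abbrev VObj (X : PosComp.{u}) : PosComp.{u} where
  carrier := VSet X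

/-- `Vf` sends `A` to the closed upper set generated by `f(A)`. -/
def VMap {X : PosComp.{u}} {Y : PosComp.{v}} (f : PosComp.Hom X Y) :
    PosComp.Hom (VObj X) (VObj Y) where
  toFun A :=
    { set := {y | ∃ z ∈ f.toFun '' A.set, z ≤ y}
      isClosed := isClosed_up (A.isClosed.isCompact.image f.continuous).isClosed
      isUpperSet := fun _ _ h ⟨z, hz, hzx⟩ => ⟨z, hz, hzx.trans h⟩ }
  monotone := fun _ _ h _ ⟨z, hz, hzy⟩ => ⟨z, Set.image_mono h hz, hzy⟩
  continuous := by
    have key : ∀ (U : Set Y.carrier), IsLowerSet U → ∀ A : VSet X,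
        ({y | ∃ z ∈ f.toFun '' A.set, z ≤ y} ∩ U).Nonempty ↔
          (A.set ∩ f.toFun ⁻¹' U).Nonempty := by
      intro U hU A
      constructor
      · rintro ⟨y, ⟨_, ⟨x, hx, rfl⟩, hzy⟩, hy⟩
        exact ⟨x, hx, hU hzy hy⟩
      · rintro ⟨x, hx, hxU⟩
        exact ⟨f.toFun x, ⟨_, ⟨x, hx, rfl⟩, le_rfl⟩, hxU⟩
    refine VSet.continuous_iff.2 ⟨fun U hU hU' => ?_, fun K hK hK' => ?_⟩
    · convert VSet.isOpen_hit (hU.preimage f.continuous) (hU'.preimage f.monotone) using 1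
      ext A
      exact key U hU' A
    · convert VSet.isOpen_miss (hK.preimage f.continuous) (hK'.preimage f.monotone) using 1
      ext A
      simp only [VSet.miss, Set.mem_preimage, Set.mem_ofPred_eq, ← Set.not_nonempty_iff_eq_empty]
      exact not_congr (key K hK' A)

/-- The unit `x ↦ ↑x`. -/
def VUnit (X : PosComp.{u}) : PosComp.Hom X (VObj X) where
  toFun x := { set := Set.Ici x, isClosed := isClosed_Ici, isUpperSet := isUpperSet_Ici x }
  monotone _ _ h := Set.Ici_subset_Ici.2 h
  continuous := by
    have key : ∀ (U : Set X.carrier), IsLowerSet U → ∀ x, (Set.Ici x ∩ U).Nonempty ↔ x ∈ U :=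
      fun U hU x => ⟨fun ⟨y, hxy, hy⟩ => hU hxy hy, fun hx => ⟨x, le_rfl, hx⟩⟩
    refine VSet.continuous_iff.2 ⟨fun U hU hU' => ?_, fun K hK hK' => ?_⟩
    · convert hU using 1
      ext x
      exact key U hU' x
    · convert hK.isOpen_compl using 1
      ext x
      simp only [VSet.miss, Set.mem_preimage, Set.mem_ofPred_eq, ← Set.not_nonempty_iff_eq_empty]
      exact not_congr (key K hK' x)

/-- The multiplication `𝒜 ↦ ⋃ 𝒜`. -/
def VMult (X : PosComp.{u}) : PosComp.Hom (VObj (VObj X)) (VObj X) where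
  toFun 𝒜 :=
    { set := {x | ∃ A ∈ 𝒜.set, x ∈ A.set}
      isClosed := by
        convert 𝒜.isClosed.preimage (VUnit X).continuous using 1
        ext x
        constructor
        · rintro ⟨A, hA, hx⟩
          exact 𝒜.isUpperSet (show A ≤ (VUnit X).toFun x from
            fun y hy => A.isUpperSet hy hx) hA
        · exact fun h => ⟨_, h, le_rfl⟩
      isUpperSet := fun _ _ h ⟨A, hA, hx⟩ => ⟨A, hA, A.isUpperSet h hx⟩ }
  monotone _ _ h := fun _ ⟨A, hA, hx⟩ => ⟨A, h hA, hx⟩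
  continuous := by
    have key : ∀ (U : Set X.carrier) (𝒜 : VSet (VObj X)),
        ({x | ∃ A ∈ 𝒜.set, x ∈ A.set} ∩ U).Nonempty ↔ (𝒜.set ∩ VSet.hit U).Nonempty :=
      fun U 𝒜 => ⟨fun ⟨x, ⟨A, hA, hx⟩, hxU⟩ => ⟨A, hA, x, hx, hxU⟩,
        fun ⟨A, hA, x, hx, hxU⟩ => ⟨x, ⟨A, hA, hx⟩, hxU⟩⟩
    refine VSet.continuous_iff.2 ⟨fun U hU hU' => ?_, fun K hK hK' => ?_⟩
    · convert VSet.isOpen_hit (X := VObj X) (VSet.isOpen_hit hU hU') (VSet.isLowerSet_hit U) using 1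
      ext 𝒜
      exact key U 𝒜
    · have hc : IsClosed (VSet.hit K) := by
        rw [← VSet.compl_miss]
        exact (VSet.isOpen_miss hK hK').isClosed_compl
      convert VSet.isOpen_miss (X := VObj X) hc (VSet.isLowerSet_hit K) using 1
      ext 𝒜
      simp only [VSet.miss, Set.mem_preimage, Set.mem_ofPred_eq, ← Set.not_nonempty_iff_eq_empty]
      exact not_congr (key K 𝒜)

/-- The Vietoris monad on `PosComp`. -/
def V : Monad PosComp.{u} where
  obj := VObj
  map f := VMap f
  map_id X := by
    refine PosComp.Hom.ext (funext fun A => VSet.ext (Set.ext fun x => ?_))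
    constructor
    · rintro ⟨_, ⟨y, hy, rfl⟩, hyx⟩
      exact A.isUpperSet hyx hy
    · exact fun hx => ⟨x, ⟨x, hx, rfl⟩, le_rfl⟩
  map_comp f g := by
    refine PosComp.Hom.ext (funext fun A => VSet.ext (Set.ext fun x => ?_))
    constructor
    · rintro ⟨_, ⟨y, hy, rfl⟩, hyx⟩
      exact ⟨_, ⟨_, ⟨_, ⟨y, hy, rfl⟩, le_rfl⟩, rfl⟩, hyx⟩
    · rintro ⟨_, ⟨y, ⟨_, ⟨z, hz, rfl⟩, hzy⟩, rfl⟩, hyx⟩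
      exact ⟨_, ⟨z, hz, rfl⟩, (g.monotone hzy).trans hyx⟩
  η :=
    { app := fun X => VUnit X
      naturality := fun X Y f => by
        refine PosComp.Hom.ext (funext fun x => VSet.ext (Set.ext fun y => ?_))
        constructor
        · exact fun h => ⟨_, ⟨x, le_rfl, rfl⟩, h⟩
        · rintro ⟨_, ⟨z, hz, rfl⟩, hzy⟩
          exact (f.monotone hz).trans hzy }
  μ :=
    { app := fun X => VMult X
      naturality := fun X Y f => by
        refine PosComp.Hom.ext (funext fun 𝒜 => VSet.ext (Set.ext fun y => ?_))
        constructor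
        · rintro ⟨B, ⟨_, ⟨A, hA, rfl⟩, hAB⟩, hy⟩
          obtain ⟨_, ⟨x, hx, rfl⟩, hxy⟩ := hAB hy
          exact ⟨_, ⟨x, ⟨A, hA, hx⟩, rfl⟩, hxy⟩
        · rintro ⟨_, ⟨x, ⟨A, hA, hx⟩, rfl⟩, hxy⟩
          exact ⟨_, ⟨_, ⟨A, hA, rfl⟩, le_rfl⟩, _, ⟨x, hx, rfl⟩, hxy⟩ }
  assoc X := by
    refine PosComp.Hom.ext (funext fun 𝒜 => VSet.ext (Set.ext fun x => ?_))
    constructor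
    · rintro ⟨A, ⟨_, ⟨ℬ, hℬ, rfl⟩, hA⟩, hx⟩
      obtain ⟨B, hB, hxB⟩ := hA hx
      exact ⟨B, ⟨ℬ, hℬ, hB⟩, hxB⟩
    · rintro ⟨B, ⟨ℬ, hℬ, hB⟩, hx⟩
      exact ⟨_, ⟨_, ⟨ℬ, hℬ, rfl⟩, le_rfl⟩, B, hB, hx⟩
  left_unit X := by
    refine PosComp.Hom.ext (funext fun A => VSet.ext (Set.ext fun x => ?_))
    constructor
    · rintro ⟨B, hB, hx⟩
      exact hB hx
    · exact fun hx => ⟨A, le_refl (α := VSet X) A, hx⟩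
  right_unit X := by
    refine PosComp.Hom.ext (funext fun A => VSet.ext (Set.ext fun x => ?_))
    constructor
    · rintro ⟨B, ⟨_, ⟨y, hy, rfl⟩, hB⟩, hx⟩
      exact A.isUpperSet (hB hx) hy
    · exact fun hx => ⟨_, ⟨_, ⟨x, hx, rfl⟩, le_rfl⟩, le_rfl⟩

/-! ### The monad morphism `j` -/

theorem lowerSet_lt {X : PosComp.{u}} (ψ : CSet X) (c : unitInterval) :
    IsOpen {x | c < ψ.val x} ∧ IsLowerSet {x | c < ψ.val x} :=
  ⟨isOpen_lt continuous_const ψ.val_continuous, fun _ _ h h' => lt_of_lt_of_le h' (ψ.val_antitone h)⟩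

theorem lowerSet_le {X : PosComp.{u}} (ψ : CSet X) (c : unitInterval) :
    IsClosed {x | c ≤ ψ.val x} ∧ IsLowerSet {x | c ≤ ψ.val x} :=
  ⟨isClosed_le continuous_const ψ.val_continuous, fun _ _ h h' => le_trans h' (ψ.val_antitone h)⟩

/-- The function `A ↦ sup_{x ∈ A} ψ x`, as an element of `CVX`. -/
noncomputable def supC {X : PosComp.{u}} (ψ : CSet X) : CSet (VObj X) :=
  CSet.mk' (fun A => ⨆ x ∈ A.set, ψ.val x) (fun _ _ h => biSup_mono h) (by
    refine OrderTopology.continuous_iff.2 fun c => ⟨?_, ?_⟩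
    · convert VSet.isOpen_hit (lowerSet_lt ψ c).1 (lowerSet_lt ψ c).2 using 1
      ext A
      simp only [Set.mem_preimage, Set.mem_Ioi, lt_iSup_iff, VSet.hit]
      constructor
      · rintro ⟨x, hx, hxc⟩
        exact ⟨x, hx, hxc⟩
      · rintro ⟨x, hx, hxc⟩
        exact ⟨x, hx, hxc⟩
    · rcases eq_or_lt_of_le (bot_le : ⊥ ≤ c) with rfl | hc
      · convert isOpen_empty
        ext A
        simp
      · convert VSet.isOpen_miss (lowerSet_le ψ c).1 (lowerSet_le ψ c).2 using 1
        ext A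
        simp only [Set.mem_preimage, Set.mem_Iio, VSet.miss, Set.mem_ofPred_eq]
        constructor
        · intro h
          refine Set.eq_empty_iff_forall_notMem.2 fun x hx => ?_
          exact absurd ((hx.2.trans (le_iSup₂ x hx.1)).trans_lt h) (lt_irrefl _)
        · intro h
          rcases A.set.eq_empty_or_nonempty with hA | hA
          · simpa [hA] using hc
          · obtain ⟨x, hx, hmax⟩ := A.isClosed.isCompact.exists_isMaxOn hA
              ψ.val_continuous.continuousOn
            have : ψ.val x < c := by
              by_contra hxc
              exact Set.eq_empty_iff_forall_notMem.1 h x ⟨hx, not_lt.1 hxc⟩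
            exact (iSup₂_le fun y hy => hmax hy).trans_lt this)

/-- `ψ ↦ (A ↦ sup_{x ∈ A} ψ x)` as a morphism `CX → CVX`. -/
noncomputable def kappa (T : ContTNorm) (X : PosComp.{u}) :
    LaxMnd.Hom (CObj T X) (CObj T (VObj X)) where
  toFun := supC
  isFinCocont :=
    { functor := fun ψ φ => le_iInf fun A : VSet X => by
        change (⨅ x, T.ihom (CSet.val ψ x) (CSet.val φ x)) ≤
          T.ihom (⨆ x ∈ A.set, CSet.val ψ x) (⨆ x ∈ A.set, CSet.val φ x)
        simp only [T.le_ihom, T.iSup_tens]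
        refine iSup₂_le fun x hx => le_iSup₂_of_le x hx ?_
        exact T.le_ihom.1 (iInf_le _ x)
      cocont := fun B _ h ψ _ _ χ hχ => by
        refine isColimit_CVCat_iff.2 fun A : VSet X => ?_
        change (⨆ x ∈ A.set, CSet.val χ x) = ⨆ z, T.tens (⨆ x ∈ A.set, CSet.val (h z) x) (ψ z)
        simp only [isColimit_CVCat_iff.1 hχ, T.iSup_tens]
        exact le_antisymm
          (iSup₂_le fun x hx => iSup_mono fun z => le_iSup₂_of_le x hx le_rfl)
          (iSup_le fun z => iSup₂_mono fun x _ => le_iSup_of_le z le_rfl) }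
  lax ψ φ := CVCat_le_iff.2 fun A : VSet X => by
    change (⨆ x ∈ A.set, T.tens (CSet.val ψ x) (CSet.val φ x)) ≤
      T.tens (⨆ x ∈ A.set, CSet.val ψ x) (⨆ x ∈ A.set, CSet.val φ x)
    exact iSup₂_le fun x hx => T.tens_mono
      (le_iSup₂ (f := fun x (_ : x ∈ A.set) => CSet.val ψ x) x hx)
      (le_iSup₂ (f := fun x (_ : x ∈ A.set) => CSet.val φ x) x hx)

/-- `Φ_A : CX → [0,1]`, `ψ ↦ sup_{x ∈ A} ψ x`. -/
noncomputable def Phi (T : ContTNorm) {X : PosComp.{u}} (A : VSet X) : GSet (CObj T X) where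
  toFun := fun ψ : CSet X => iSup (α := unitInterval) fun x => ⨆ _ : x ∈ A.set, ψ.val x
  isFinCocont := (((unitEv T (VObj X)).toFun A).isFinCocont).comp (kappa T X).isFinCocont
  lax := (LaxMnd.Hom.comp (kappa T X) ((unitEv T (VObj X)).toFun A)).lax

/-- The components `j_X : VX → GCX`, `A ↦ Φ_A`. -/
noncomputable def jHom (T : ContTNorm) (X : PosComp.{u}) :
    PosComp.Hom (VObj X) (GObj (CObj T X)) where
  toFun := Phi T
  monotone _ _ h := fun ψ => (supC ψ).val_antitone h
  continuous := GSet.continuous_iff.2 fun ψ => (supC ψ).val_continuous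

/-- The monad morphism `j` from `V` to the monad induced by `C ⊣ G`. -/
noncomputable def j (T : ContTNorm) : V.{u} ⟶ (adj.{u} T).toMonad where
  app X := jHom T X
  naturality X Y f := by
    refine PosComp.Hom.ext (funext fun A : VSet X => GSet.ext_ev fun ψ : CSet Y => ?_)
    change (⨆ y ∈ ((VMap f).toFun A).set, ψ.val y) = ⨆ x ∈ A.set, ψ.val (PosComp.Hom.toFun f x)
    refine le_antisymm (iSup₂_le ?_) (iSup₂_le fun x hx => ?_)
    · rintro y ⟨_, ⟨x, hx, rfl⟩, hxy⟩
      exact le_iSup₂_of_le x hx (ψ.val_antitone hxy)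
    · exact le_iSup₂_of_le (f := fun y (_ : y ∈ ((VMap f).toFun A).set) => ψ.val y)
        (PosComp.Hom.toFun f x) ⟨_, ⟨x, hx, rfl⟩, le_rfl⟩ le_rfl
  app_η X := by
    refine PosComp.Hom.ext (funext fun x => GSet.ext_ev fun ψ : CSet X => ?_)
    change (⨆ y ∈ Set.Ici x, ψ.val y) = ψ.val x
    exact le_antisymm (iSup₂_le fun y hy => ψ.val_antitone hy)
      (le_iSup₂_of_le x Set.self_mem_Ici le_rfl)
  app_μ X := by
    refine PosComp.Hom.ext (funext fun 𝒜 : VSet (VObj X) => GSet.ext_ev fun ψ : CSet X => ?_)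
    change (⨆ x ∈ ((VMult X).toFun 𝒜).set, ψ.val x) =
      ⨆ Φ ∈ ((VMap (jHom T X)).toFun 𝒜).set, GSet.ev (A := CObj T X) ψ Φ
    refine le_antisymm (iSup₂_le ?_) (iSup₂_le ?_)
    · rintro x ⟨A, hA, hx⟩
      refine le_iSup₂_of_le (f := fun Φ (_ : Φ ∈ ((VMap (jHom T X)).toFun 𝒜).set) =>
        GSet.ev (A := CObj T X) ψ Φ) (Phi T A) ⟨_, ⟨A, hA, rfl⟩, le_rfl⟩ ?_
      exact le_iSup₂ (f := fun x (_ : x ∈ A.set) => ψ.val x) x hx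
    · rintro Φ ⟨_, ⟨A, hA, rfl⟩, hΦ⟩
      have h1 : GSet.ev (A := CObj T X) ψ Φ ≤ ⨆ x ∈ A.set, ψ.val x := hΦ ψ
      refine h1.trans (iSup₂_le fun x hx => ?_)
      exact le_iSup₂ (f := fun x (_ : x ∈ ((VMult X).toFun 𝒜).set) => ψ.val x) x ⟨A, hA, hx⟩

/-! ### Continuous distributors -/

/-- A continuous distributor: a relation `φ` such that `x ↦ {y | x φ y}` is a morphism `X → VY` of
partially ordered compact spaces. -/
@[ext]
structure ContDist (X : PosComp.{u}) (Y : PosComp.{u}) where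
  rel : X.carrier → Y.carrier → Prop
  continuous : ∃ f : PosComp.Hom X (VObj Y), ∀ x y, rel x y ↔ y ∈ (f.toFun x).set

/-- The order relation, as identity distributor. -/
def ContDist.id (X : PosComp.{u}) : ContDist X X where
  rel x y := x ≤ y
  continuous := ⟨VUnit X, fun _ _ => Iff.rfl⟩

/-- Relational composition. -/
def ContDist.comp {X Y Z : PosComp.{u}} (φ : ContDist X Y) (χ : ContDist Y Z) : ContDist X Z where
  rel x z := ∃ y, φ.rel x y ∧ χ.rel y z
  continuous := by
    obtain ⟨f, hf⟩ := φ.continuous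
    obtain ⟨g, hg⟩ := χ.continuous
    refine ⟨(f.comp (VMap g)).comp (VMult Z), fun x z => ?_⟩
    constructor
    · rintro ⟨y, hxy, hyz⟩
      exact ⟨_, ⟨_, ⟨y, (hf x y).1 hxy, rfl⟩, le_rfl⟩, (hg y z).1 hyz⟩
    · rintro ⟨A, ⟨_, ⟨y, hy, rfl⟩, hA⟩, hz⟩
      exact ⟨y, (hf x y).2 hy, (hg y z).2 (hA hz)⟩

/-- The objects of `PosCompDist`: partially ordered compact spaces. -/
structure PosCompDist where
  toPosComp : PosComp.{u}

/-- The category `PosCompDist` of partially ordered compact spaces and continuous distributors,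
with relational composition. -/
instance : Category PosCompDist.{u} where
  Hom X Y := ContDist X.toPosComp Y.toPosComp
  id X := ContDist.id X.toPosComp
  comp φ χ := ContDist.comp φ χ
  id_comp φ := by
    obtain ⟨f, hf⟩ := ContDist.continuous φ
    refine ContDist.ext (funext fun x => funext fun y => propext ?_)
    constructor
    · rintro ⟨z, hxz, hzy⟩
      exact (hf x y).2 (f.monotone hxz ((hf z y).1 hzy))
    · exact fun h => ⟨x, le_refl x, h⟩
  comp_id φ := by
    obtain ⟨f, hf⟩ := ContDist.continuous φ
    refine ContDist.ext (funext fun x => funext fun y => propext ?_)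
    constructor
    · rintro ⟨z, hxz, hzy⟩
      exact (hf x y).2 ((f.toFun x).isUpperSet hzy ((hf x z).1 hxz))
    · exact fun h => ⟨y, h, le_refl y⟩
  assoc φ χ ω := by
    refine ContDist.ext (funext fun x => funext fun y => propext ?_)
    constructor
    · rintro ⟨z, ⟨w, h1, h2⟩, h3⟩
      exact ⟨w, h1, z, h2, h3⟩
    · rintro ⟨w, h1, z, h2, h3⟩
      exact ⟨z, ⟨w, h1, h2⟩, h3⟩

/-- `Cφ : CY → CX`, `(Cφ)(ψ)(x) = sup_{x φ y} ψ y`, for a continuous distributor `φ`. -/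
noncomputable def CDistMap (T : ContTNorm) {X Y : PosComp.{u}} (φ : ContDist X Y) :
    LaxMnd.Hom (CObj T Y) (CObj T X) :=
  have key : ∃ F : LaxMnd.Hom (CObj T Y) (CObj T X), ∀ (ψ : CSet Y) x,
      CSet.val (F.toFun ψ) x = ⨆ (y) (_ : φ.rel x y), ψ.val y := by
    obtain ⟨f, hf⟩ := φ.continuous
    refine ⟨LaxMnd.Hom.comp (kappa T Y) (CMap T f), fun ψ x => ?_⟩
    simp only [hf]
    rfl
  have hm (ψ : CSet Y) : Antitone fun x => ⨆ (y) (_ : φ.rel x y), ψ.val y := by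
    obtain ⟨F, hF⟩ := key
    simp only [← hF]
    exact CSet.val_antitone _
  have hc (ψ : CSet Y) : Continuous fun x => ⨆ (y) (_ : φ.rel x y), ψ.val y := by
    obtain ⟨F, hF⟩ := key
    simp only [← hF]
    exact CSet.val_continuous _
  have hF' : ∃ F : LaxMnd.Hom (CObj T Y) (CObj T X),
      F.toFun = fun ψ : CSet Y => CSet.mk' _ (hm ψ) (hc ψ) := by
    obtain ⟨F, hF⟩ := key
    exact ⟨F, funext fun ψ => CSet.ext_val fun x => hF ψ x⟩
  { toFun := fun ψ : CSet Y => CSet.mk' (fun x => ⨆ (y) (_ : φ.rel x y), ψ.val y) (hm ψ) (hc ψ)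
    isFinCocont := by
      obtain ⟨F, hF⟩ := hF'
      exact hF ▸ F.isFinCocont
    lax := by
      obtain ⟨F, hF⟩ := hF'
      intro ψ χ
      have h := F.lax ψ χ
      rw [hF] at h
      exact h }

/-- The functor `C : PosCompDist → LaxMnd(FinSup)ᵒᵖ`. -/
noncomputable def CDist (T : ContTNorm) : PosCompDist.{u} ⥤ (LaxMnd.{u} T)ᵒᵖ where
  obj X := Opposite.op (CObj T X.toPosComp)
  map φ := Quiver.Hom.op (CDistMap T φ)
  map_id X := by
    refine congrArg Quiver.Hom.op (LaxMnd.Hom.ext (funext fun ψ : CSet X.toPosComp =>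
      CSet.ext_val fun x => ?_))
    change (⨆ (y) (_ : x ≤ y), ψ.val y) = ψ.val x
    exact le_antisymm (iSup₂_le fun y hy => ψ.val_antitone hy) (le_iSup₂_of_le x le_rfl le_rfl)
  map_comp {X Y Z} φ χ := by
    refine congrArg Quiver.Hom.op (LaxMnd.Hom.ext (funext fun ψ : CSet Z.toPosComp =>
      CSet.ext_val fun x => ?_))
    change (⨆ (z) (_ : ∃ y, ContDist.rel φ x y ∧ ContDist.rel χ y z), ψ.val z) =
      ⨆ (y) (_ : ContDist.rel φ x y), ⨆ (z) (_ : ContDist.rel χ y z), ψ.val z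
    refine le_antisymm (iSup₂_le ?_) (iSup₂_le fun y hy => iSup₂_le fun z hz => ?_)
    · rintro z ⟨y, hy, hz⟩
      exact le_iSup₂_of_le y hy (le_iSup₂_of_le z hz le_rfl)
    · exact le_iSup₂_of_le z ⟨y, hy, hz⟩ le_rfl

end PosCompDuality

namespace PosCompDuality

/-! ### Urysohn functions on partially ordered compact spaces -/

/-! The map `j_X` is monotone and continuous between compact Hausdorff spaces, so it suffices that
it is bijective and reflects the order. The inverse sends a morphism Φ : CX → [0,1] to the set of
points x whose evaluation lies below Φ; this is `GSet.support`.

Injectivity and order reflection are Urysohn's lemma for partially ordered compact spaces: a point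
outside a closed upper set A is detected by some ψ in CX that is 1 at the point and 0 on A. The
usual dyadic construction works once the open sets in it are kept lower.

Surjectivity is `GSet.app_eq_iSup_support`: Φ is the supremum over its support. Suppose Φ(φ) < φ(x),
and choose a strictly between. Composing φ with hom(a,-) gives a function χ that equals 1 near x,
while χ ⊗ a ≤ φ forces Φ(χ) ⊗ a < a and hence Φ(χ) < 1. By laxity Φ(χⁿ) ≤ Φ(χ)ⁿ, which becomes
arbitrarily small, and χⁿ is still 1 near x. Compactness patches these local functions together over
the set where ψ ≥ c, whenever c exceeds the supremum of ψ on the support. This gives Φ(ψ) ≤ c.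

The tensor enters surjectivity only through `ContTNorm.IsArchimedean`, which both given tensors
satisfy; the minimum, whose powers are constant, would not. Full faithfulness follows because a
distributor X → Y is a map X → VY, while a morphism CY → CX yields a map X → GCY by evaluation. -/

theorem urysohn_approx_monotone {α : Type u} [TopologicalSpace α] [PartialOrder α] {P : Set α → Set α → Prop}
    (hP : ∀ s t, P s t → IsLowerSet t)
    (n : ℕ) (c : Urysohns.CU P) : Monotone (c.approx n) := by
  induction n generalizing c with
  | zero =>
    intro x y hxy
    -- The zeroth approximation is 0 on `c.U` and 1 off it, so it is monotone exactly because `hP`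
    -- makes `c.U` lower.
    by_cases hy : y ∈ c.U
    · have hx : x ∈ c.U := hP _ _ c.P_C_U hxy hy
      simp [Urysohns.CU.approx, hx, hy]
    · rw [c.approx_of_notMem_U 0 hy]
      exact c.approx_le_one 0 x
  | succ n ih =>
    intro x y hxy
    -- The next approximation averages those of the two refined pairs `c.left` and `c.right`, which
    -- is why `c` is generalized in the induction.
    exact midpoint_le_midpoint (ih _ hxy) (ih _ hxy)

theorem urysohn_lim_monotone {α : Type u} [TopologicalSpace α] [PartialOrder α] {P : Set α → Set α → Prop}
    (hP : ∀ s t, P s t → IsLowerSet t)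
    (c : Urysohns.CU P) : Monotone c.lim := fun _ _ hxy =>
  ciSup_mono (c.bddAbove_range_approx _) fun n => urysohn_approx_monotone hP n c hxy

/-! ### Order-theoretic normality and separation by antitone functions. -/

section Nachbin

variable {α : Type u} [TopologicalSpace α] [PartialOrder α] [CompactSpace α]
  [OrderClosedTopology α]

/-- Between a closed set and an open lower set containing it there is an open lower set whose
closure lies in the given one. -/
theorem exists_isOpen_isLowerSet_between {c u : Set α} (hc : IsClosed c) (hu : IsOpen u)
    (hu' : IsLowerSet u) (hcu : c ⊆ u) :
    ∃ v, IsOpen v ∧ IsLowerSet v ∧ c ⊆ v ∧ closure v ⊆ u := by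
  obtain ⟨P, Q, hP, hQ, huP, hcQ, hPQ⟩ := normal_separation hu.isClosed_compl (isClosed_down hc)
    (Set.disjoint_left.2 fun y hy ⟨x, hx, hyx⟩ => hy (hu' hyx (hcu hx)))
  have hvQ : {y | ∃ x ∈ Qᶜ, x ≤ y}ᶜ ⊆ Q := fun y hy => by
    by_contra h
    exact hy ⟨y, h, le_rfl⟩
  -- The witness is the largest lower set inside `Q`. It is open because upward closures of closed
  -- sets are closed, it contains `c` because `Q` contains the downward closure of `c`, and its
  -- closure avoids `P`, which contains the complement of `u`.
  refine ⟨{y | ∃ x ∈ Qᶜ, x ≤ y}ᶜ, (isClosed_up hQ.isClosed_compl).isOpen_compl, ?_, ?_, ?_⟩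
  · rintro x y hyx hx ⟨z, hz, hzy⟩
    exact hx ⟨z, hz, hzy.trans hyx⟩
  · rintro x hx ⟨z, hz, hzx⟩
    exact hz (hcQ ⟨x, hx, hzx⟩)
  · refine (closure_minimal (hvQ.trans fun y hyQ hyP => Set.disjoint_left.1 hPQ hyP hyQ)
      hP.isClosed_compl).trans fun y hy => ?_
    by_contra h
    exact hy (huP h)

/-- A closed upper set and a point outside it are separated by a continuous antitone function to
the unit interval. -/
theorem exists_antitone_continuous_eq_one_eq_zero {A : Set α} (hA : IsClosed A)
    (hA' : IsUpperSet A) {b : α} (hb : b ∉ A) :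
    ∃ f : α → unitInterval, Antitone f ∧ Continuous f ∧ f b = 1 ∧ ∀ x ∈ A, f x = 0 := by
  -- The predicate constrains only the outer open set. The inner closed sets, such as `{b}`, need
  -- not be lower.
  let c : Urysohns.CU (X := α) fun _ t => IsLowerSet t :=
    { C := {b}
      U := Aᶜ
      P_C_U := hA'.compl
      closed_C := isClosed_singleton
      open_U := hA.isOpen_compl
      subset := Set.singleton_subset_iff.2 hb
      hP := fun {s t} hs ht ht' hst => by
        obtain ⟨v, hv, hv', hsv, hvt⟩ := exists_isOpen_isLowerSet_between hs ht' ht hst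
        exact ⟨v, hv, hsv, hvt, hv', ht⟩ }
  -- The Urysohn limit is monotone, 0 at `b` and 1 on `A`; reflecting the interval gives the
  -- antitone function.
  refine ⟨fun x => unitInterval.symm ⟨c.lim x, c.lim_mem_Icc x⟩, fun _ _ hxy => ?_, ?_, ?_,
    fun x hx => ?_⟩
  · exact unitInterval.symm_le_symm.2 (urysohn_lim_monotone (fun _ _ h => h) c hxy)
  · exact unitInterval.continuous_symm.comp (c.continuous_lim.subtype_mk _)
  · ext
    simp [c.lim_of_mem_C b (Set.mem_singleton b)]
  · ext
    simp [c.lim_of_notMem_U x (fun h => h hx)]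

end Nachbin

/-! ### Archimedean continuous t-norms -/

namespace ContTNorm

/-- Powers for the tensor product. -/
def npow (T : ContTNorm) (a : unitInterval) : ℕ → unitInterval
  | 0 => 1
  | n + 1 => T.tens a (npow T a n)

theorem zero_tens (T : ContTNorm) (a : unitInterval) : T.tens 0 a = 0 :=
  le_antisymm (T.tens_le_left 0 a) unitInterval.nonneg'

/-- The powers of elements below `1` tend to `0`, and for `a > 0` there is a continuous monotone
function below `hom(a,-)` with value `1` from `a` on. -/
structure IsArchimedean (T : ContTNorm) : Prop where
  exists_npow_le : ∀ a c : unitInterval, a < 1 → 0 < c → ∃ n, T.npow a n ≤ c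
  exists_residual : ∀ a : unitInterval, 0 < a → ∃ g : unitInterval → unitInterval,
    Monotone g ∧ Continuous g ∧ (∀ b, T.tens (g b) a ≤ b) ∧ ∀ b, a ≤ b → g b = 1

end ContTNorm

theorem coe_mulTNorm_npow (a : unitInterval) (n : ℕ) :
    (mulTNorm.npow a n : ℝ) = (a : ℝ) ^ n := by
  induction n with
  | zero => simp [ContTNorm.npow]
  | succ n ih => rw [pow_succ', ← ih]; rfl

theorem mulTNorm_isArchimedean : mulTNorm.IsArchimedean where
  exists_npow_le a c ha hc := by
    obtain ⟨n, hn⟩ := exists_pow_lt_of_lt_one (show (0 : ℝ) < c from hc) (show (a : ℝ) < 1 from ha)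
    exact ⟨n, Subtype.coe_le_coe.1 ((coe_mulTNorm_npow a n).trans_le hn.le)⟩
  exists_residual a ha := by
    have ha' : (0 : ℝ) < a := ha
    -- This is hom(a,-) itself, which is continuous because `a` is positive.
    refine ⟨fun b => ⟨min 1 (b / a), le_min zero_le_one (div_nonneg b.2.1 a.2.1), min_le_left _ _⟩,
      fun b c hbc => ?_, by fun_prop, fun b => ?_, fun b hb => ?_⟩
    · have : (b : ℝ) ≤ c := hbc
      exact Subtype.coe_le_coe.1 (min_le_min le_rfl (by gcongr))
    · refine Subtype.coe_le_coe.1 ?_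
      change min 1 ((b : ℝ) / a) * a ≤ b
      exact (mul_le_mul_of_nonneg_right (min_le_right _ _) ha'.le).trans_eq
        (div_mul_cancel₀ _ ha'.ne')
    · ext
      exact min_eq_left ((one_le_div ha').2 hb)

/-- Each further factor `a` subtracts 1 - a, until truncation at 0. -/
theorem coe_lukTNorm_npow_le (a : unitInterval) (n : ℕ) :
    ((lukTNorm.npow a n : unitInterval) : ℝ) ≤ max 0 (1 - (n : ℝ) * (1 - (a : ℝ))) := by
  induction n with
  | zero => simp [ContTNorm.npow]
  | succ n ih =>
    have h : (lukTNorm.npow a (n + 1) : ℝ) = max 0 ((a : ℝ) + lukTNorm.npow a n - 1) := rfl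
    have := a.2.1; have := a.2.2
    rw [h]
    push_cast
    rcases le_max_iff.1 ih with h0 | h0
    · exact max_le (le_max_left _ _) (le_max_of_le_left (by linarith))
    · exact max_le (le_max_left _ _) (le_max_of_le_right (by linarith))

theorem lukTNorm_isArchimedean : lukTNorm.IsArchimedean where
  exists_npow_le a c ha hc := by
    have ha' : (a : ℝ) < 1 := ha
    -- With this `n` the bound of `coe_lukTNorm_npow_le` is 0: proper elements are nilpotent for the
    -- Łukasiewicz tensor.
    obtain ⟨n, hn⟩ := exists_nat_ge (1 / (1 - (a : ℝ)))
    refine ⟨n, Subtype.coe_le_coe.1 ((coe_lukTNorm_npow_le a n).trans (max_le c.2.1 ?_))⟩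
    have := (div_le_iff₀ (by linarith)).1 hn
    linarith [c.2.1]
  exists_residual a ha := by
    -- Again hom(a,-) itself.
    refine ⟨fun b => ⟨min 1 (1 - a + b), le_min zero_le_one (by linarith [a.2.2, b.2.1]),
      min_le_left _ _⟩, fun b c hbc => ?_, by fun_prop, fun b => ?_, fun b hb => ?_⟩
    · have : (b : ℝ) ≤ c := hbc
      exact Subtype.coe_le_coe.1 (min_le_min le_rfl (by linarith))
    · refine Subtype.coe_le_coe.1 ?_
      change max 0 (min 1 (1 - (a : ℝ) + b) + a - 1) ≤ b
      exact max_le b.2.1 (by linarith [min_le_right (1 : ℝ) (1 - a + b)])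
    · have : (a : ℝ) ≤ b := hb
      ext
      exact min_eq_left (by linarith)

/-! ### Operations on `CX` and morphisms `CX → [0,1]` -/

namespace CSet

variable {X : PosComp.{u}}

/-- Powers for the pointwise tensor. -/
def npow (T : ContTNorm) (ψ : CSet X) : ℕ → CSet X
  | 0 => one
  | n + 1 => mul T ψ (npow T ψ n)

theorem npow_val_eq_one (T : ContTNorm) {ψ : CSet X} {x : X.carrier} (h : ψ.val x = 1) (n : ℕ) :
    (npow T ψ n).val x = 1 := by
  induction n with
  | zero => rfl
  | succ n ih =>
    change T.tens (ψ.val x) ((npow T ψ n).val x) = 1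
    rw [h, ih, T.tens_one]

end CSet

/-- The discrete `[0,1]`-category on a set. -/
noncomputable def discreteVCat (T : ContTNorm) (ι : Type u) : VCat.{u} T where
  carrier := ι
  a x y := ⨆ _ : x = y, 1
  refl x := by simp
  trans x y z := by
    by_cases h : x = y
    · subst h
      by_cases h : x = z <;> simp [h, T.one_tens]
    · simp [h, bot_eq_zero, T.zero_tens]

/-- Together with `isWeight_discreteVCat`, this lets arbitrary finite families with arbitrary
weights serve as diagrams. -/
theorem isFunctor_discreteVCat {T : ContTNorm} {ι : Type u} (X : VCat.{v} T) (h : ι → X.carrier) :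
    VCat.IsFunctor (discreteVCat T ι) X h := fun x y => by
  refine iSup_le fun hxy : x = y => ?_
  subst hxy
  exact X.refl _

theorem isWeight_discreteVCat {T : ContTNorm} {ι : Type u} (ψ : ι → unitInterval) :
    VCat.IsWeight (discreteVCat T ι) ψ := fun x y => by
  change T.tens (⨆ _ : x = y, 1) (ψ y) ≤ ψ x
  rw [T.iSup_tens]
  refine iSup_le fun hxy => ?_
  rw [hxy, T.one_tens]

/-! ### Recovering the closed upper set that represents a morphism. -/

namespace GSet

variable {T : ContTNorm} {X : PosComp.{u}} (Φ : GSet (CObj T X))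

/-- The value of a morphism `CX → [0,1]` at `ψ`. -/
noncomputable def app (ψ : CSet X) : unitInterval := ev (A := CObj T X) ψ Φ

/-- Finite cocontinuity on discrete shapes. It covers the cases used below: the empty shape gives
Φ(0) = 0, one point gives compatibility with tensoring by a constant, and two points give weighted
binary suprema. -/
theorem app_supTens {ι : Type} [Finite ι] (h : ι → CSet X) (w : ι → unitInterval) :
    Φ.app (CSet.supTens T h w) = ⨆ z, T.tens (Φ.app (h z)) (w z) := by
  have : Finite (discreteVCat T ι).carrier := ‹Finite ι›
  exact isColimit_unitVCat_iff.1 (Φ.isFinCocont.cocont (discreteVCat T ι) this h w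
    (isFunctor_discreteVCat (CObj T X).toVCat h) (isWeight_discreteVCat w) (CSet.supTens T h w)
    (isColimit_CVCat_iff.2 fun _ => rfl))

theorem app_mono {ψ φ : CSet X} (h : ∀ x, ψ.val x ≤ φ.val x) : Φ.app ψ ≤ Φ.app φ :=
  T.one_le_ihom.1 ((CVCat_le_iff.2 h).trans (Φ.isFinCocont.functor ψ φ))

theorem app_mul_le (ψ φ : CSet X) : Φ.app (CSet.mul T ψ φ) ≤ T.tens (Φ.app ψ) (Φ.app φ) :=
  T.one_le_ihom.1 (Φ.lax ψ φ)

theorem app_npow_le (ψ : CSet X) (n : ℕ) : Φ.app (CSet.npow T ψ n) ≤ T.npow (Φ.app ψ) n := by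
  induction n with
  -- Morphisms need not preserve the unit; only the upper bound is needed.
  | zero => exact unitInterval.le_one'
  | succ n ih => exact (Φ.app_mul_le ψ _).trans (T.tens_mono_right ih)

/-- A point at which some function exceeds its `Φ`-value has a neighbourhood on which a function
with arbitrarily small `Φ`-value equals one. -/
theorem exists_eq_one_app_le (hT : T.IsArchimedean) {x : X.carrier} {φ : CSet X}
    (hx : Φ.app φ < φ.val x) {c : unitInterval} (hc : 0 < c) :
    ∃ χ : CSet X, (∀ᶠ y in 𝓝 x, χ.val y = 1) ∧ Φ.app χ ≤ c := by
  obtain ⟨a, ha, hax⟩ := exists_between hx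
  obtain ⟨g, hgm, hgc, hg, hg1⟩ := hT.exists_residual a (unitInterval.nonneg'.trans_lt ha)
  -- `χ` is 1 wherever φ ≥ a, and χ ⊗ a ≤ φ pointwise.
  let χ : CSet X := CSet.mk' (fun y => g (φ.val y)) (hgm.comp_antitone φ.val_antitone)
    (hgc.comp φ.val_continuous)
  have h1 : T.tens (Φ.app χ) a ≤ Φ.app φ := by
    -- A one-point diagram weighted by `a` computes Φ(χ ⊗ a) = Φ(χ) ⊗ a.
    have h2 := Φ.app_supTens (ι := Unit) (fun _ => χ) (fun _ => a)
    rw [iSup_unique] at h2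
    rw [← h2]
    exact Φ.app_mono fun y => iSup_le fun _ => hg (φ.val y)
  -- If Φ(χ) were 1, then `h1` would read a ≤ Φ(φ), against the choice of `a`.
  have h2 : Φ.app χ < 1 := by
    refine lt_of_le_of_ne unitInterval.le_one' fun h => ?_
    rw [h, T.one_tens] at h1
    exact absurd ha h1.not_gt
  obtain ⟨n, hn⟩ := hT.exists_npow_le _ c h2 hc
  refine ⟨CSet.npow T χ n, ?_, (Φ.app_npow_le χ n).trans hn⟩
  filter_upwards [φ.val_continuous.continuousAt.eventually (lt_mem_nhds hax)] with y hy
  exact CSet.npow_val_eq_one T (ψ := χ) (hg1 _ hy.le) n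

/-- The closed upper set represented by a morphism `CX → [0,1]`. -/
def support : VSet X where
  set := {x | ∀ ψ : CSet X, ψ.val x ≤ Φ.app ψ}
  isClosed := by
    simp only [Set.ofPred_forall]
    exact isClosed_iInter fun ψ => isClosed_le ψ.val_continuous continuous_const
  isUpperSet _ _ hxy hx ψ := (ψ.val_antitone hxy).trans (hx ψ)

theorem app_supTens_le {ι : Type} [Finite ι] {h : ι → CSet X} {w : ι → unitInterval}
    {c : unitInterval} (hc : ∀ z, T.tens (Φ.app (h z)) (w z) ≤ c) :
    Φ.app (CSet.supTens T h w) ≤ c :=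
  (Φ.app_supTens h w).trans_le (iSup_le hc)

/-- The lower bound is the definition of the support. For the upper bound, any `c` above the
supremum makes {ψ ≥ c} a compact set disjoint from the support, so it can be covered by
neighbourhoods on which functions with Φ-value at most `c` equal 1. -/
theorem app_eq_iSup_support (hT : T.IsArchimedean) (ψ : CSet X) :
    Φ.app ψ = ⨆ x ∈ Φ.support.set, ψ.val x := by
  refine le_antisymm (le_of_forall_gt_imp_ge_of_dense fun c hc => ?_) (iSup₂_le fun x hx => hx ψ)
  have hK : IsCompact {x | c ≤ ψ.val x} :=
    (isClosed_le continuous_const ψ.val_continuous).isCompact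
  -- The property passes to subsets, holds for the empty set through the empty supremum, and passes
  -- to unions through the pointwise maximum of two functions; the last case is the local one.
  obtain ⟨χ, hχ, hΦχ⟩ := hK.induction_on
    (p := fun s => ∃ χ : CSet X, (∀ x ∈ s, χ.val x = 1) ∧ Φ.app χ ≤ c)
    ⟨CSet.supTens T (ι := Empty) (fun z => z.elim) fun z => z.elim, by simp,
      Φ.app_supTens_le fun z => z.elim⟩
    (fun s t hst ⟨χ, hχ, hc⟩ => ⟨χ, fun x hx => hχ x (hst hx), hc⟩)
    (by
      rintro s t ⟨χ, hχ, hχc⟩ ⟨ω, hω, hωc⟩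
      refine ⟨CSet.supTens T (fun b => cond b χ ω) fun _ => 1, fun x hx => ?_,
        Φ.app_supTens_le fun b => ?_⟩
      · refine le_antisymm unitInterval.le_one' ?_
        rcases hx with hx | hx
        · exact le_iSup_of_le true (by simp [T.tens_one, hχ x hx])
        · exact le_iSup_of_le false (by simp [T.tens_one, hω x hx])
      · cases b
        · exact (T.tens_le_left _ _).trans hωc
        · exact (T.tens_le_left _ _).trans hχc)
    (by
      intro x hx
      -- A point of the support with ψ(x) ≥ c would push the supremum up to `c`.
      have hxs : x ∉ Φ.support.set := fun h =>
        ((le_iSup₂ (f := fun x (_ : x ∈ Φ.support.set) => ψ.val x) x h).trans_lt hc).not_ge hx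
      obtain ⟨φ, hφ⟩ := not_forall.1 hxs
      obtain ⟨χ, hχ, hχc⟩ := Φ.exists_eq_one_app_le hT (not_le.1 hφ)
        (unitInterval.nonneg'.trans_lt hc)
      exact ⟨_, mem_nhdsWithin_of_mem_nhds hχ, χ, fun y hy => hy, hχc⟩)
  -- Pointwise ψ ≤ max(χ, c): where ψ ≥ c the function χ is 1, elsewhere the constant dominates. The
  -- constant is written as 1 ⊗ c, so its Φ-value is Φ(1) ⊗ c ≤ c.
  refine le_trans (Φ.app_mono fun x => ?_) (Φ.app_supTens_le
    (h := fun b => cond b χ CSet.one) (w := fun b => cond b 1 c) fun b => ?_)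
  · rcases le_total c (ψ.val x) with hx | hx
    · refine le_iSup_of_le true ?_
      simpa [T.tens_one, hχ x hx] using unitInterval.le_one'
    · refine le_iSup_of_le false ?_
      change ψ.val x ≤ T.tens 1 c
      rwa [T.one_tens]
  · cases b
    · change T.tens _ c ≤ c
      rw [T.tens_comm]
      exact T.tens_le_left _ _
    · exact (T.tens_le_left _ _).trans hΦχ

end GSet

/-! ### The isomorphism `VX ≅ GCX` -/

/-- Both orders are reversed, so the hypothesis bounds suprema over `B` by suprema over `A`. A point
of `B` outside `A` contradicts this for the separating Urysohn function. This also gives injectivity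
of `Phi`. -/
theorem Phi_le_Phi (T : ContTNorm) {X : PosComp.{u}} {A B : VSet X} (h : Phi T A ≤ Phi T B) :
    A ≤ B := by
  intro x hxB
  by_contra hxA
  obtain ⟨f, hf, hfc, hx, hA⟩ :=
    exists_antitone_continuous_eq_one_eq_zero A.isClosed A.isUpperSet hxA
  have h1 : (⨆ y ∈ B.set, f y) ≤ ⨆ y ∈ A.set, f y := h (CSet.mk' f hf hfc)
  have h2 : (⨆ y ∈ A.set, f y) ≤ 0 := iSup₂_le fun y hy => (hA y hy).le
  have h3 : (1 : unitInterval) ≤ ⨆ y ∈ B.set, f y :=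
    hx.symm.le.trans (le_iSup₂ (f := fun y (_ : y ∈ B.set) => f y) x hxB)
  exact absurd ((h3.trans h1).trans h2) (not_le.2 zero_lt_one)

theorem Phi_support {T : ContTNorm} (hT : T.IsArchimedean) {X : PosComp.{u}}
    (Φ : GSet (CObj T X)) : Phi T Φ.support = Φ :=
  GSet.ext_ev fun ψ => (Φ.app_eq_iSup_support hT ψ).symm

/-- `Phi` sends both sides to the same morphism by `Phi_support`, and it reflects the order. -/
theorem support_Phi {T : ContTNorm} (hT : T.IsArchimedean) {X : PosComp.{u}} (A : VSet X) :
    (Phi T A).support = A :=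
  have h := Phi_support hT (Phi T A)
  le_antisymm (Phi_le_Phi T h.le) (Phi_le_Phi T h.ge)

/-- The inverse of `j_X`. -/
noncomputable def jInv {T : ContTNorm} (hT : T.IsArchimedean) (X : PosComp.{u}) :
    PosComp.Hom (GObj (CObj T X)) (VObj X) where
  toFun := GSet.support
  monotone Φ Ψ h := Phi_le_Phi (T := T) (by rwa [Phi_support hT, Phi_support hT])
  continuous := by
    let e : VSet X ≃ GSet (CObj T X) :=
      { toFun := Phi T
        invFun := GSet.support
        left_inv := support_Phi hT
        right_inv := Phi_support hT }
    -- A continuous bijection from a compact space to a Hausdorff space is a homeomorphism; GCX is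
    -- Hausdorff because its partial order is closed.
    exact (Continuous.homeoOfEquivCompactToT2 (f := e) (jHom T X).continuous).symm.continuous

/-- Invertibility of the components suffices, since the functor forgetting monads to endofunctors
reflects isomorphisms. -/
theorem isIso_j {T : ContTNorm} (hT : T.IsArchimedean) : IsIso (j.{u} T) := by
  have (X : PosComp.{u}) : IsIso ((j T).toNatTrans.app X) :=
    ⟨jInv hT X, PosComp.Hom.ext (funext (support_Phi hT)),
      PosComp.Hom.ext (funext (Phi_support hT))⟩
  have : IsIso ((monadToFunctor PosComp.{u}).map (j T)) :=
    NatIso.isIso_of_isIso_app (j T).toNatTrans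
  exact isIso_of_reflects_iso (j T) (monadToFunctor PosComp.{u})

/-! ### The functor `C` on `PosCompDist` -/

/-- Evaluating at `x` after applying the functor to φ gives the morphism `Phi` of the closed upper
set of points related to `x`; taking supports recovers that set. -/
theorem CDist_faithful {T : ContTNorm} (hT : T.IsArchimedean) : (CDist.{u} T).Faithful where
  map_injective {X Y φ χ} h := by
    obtain ⟨f, hf⟩ := ContDist.continuous φ
    obtain ⟨g, hg⟩ := ContDist.continuous χ
    have key (x) : f.toFun x = g.toFun x := by
      rw [← support_Phi hT (f.toFun x), ← support_Phi hT (g.toFun x)]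
      refine congrArg GSet.support (GSet.ext_ev fun ψ : CSet Y.toPosComp => ?_)
      have h1 := congrArg (fun F : LaxMnd.Hom (CObj T Y.toPosComp) (CObj T X.toPosComp) =>
        CSet.val (F.toFun ψ) x) (congrArg Quiver.Hom.unop h)
      change (⨆ (y) (_ : ContDist.rel φ x y), ψ.val y) =
        ⨆ (y) (_ : ContDist.rel χ x y), ψ.val y at h1
      simp only [hf, hg] at h1
      exact h1
    refine ContDist.ext (funext fun x => funext fun y => propext ?_)
    rw [hf, hg, key]

theorem CDist_full {T : ContTNorm} (hT : T.IsArchimedean) : (CDist.{u} T).Full where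
  map_surjective {X Y} F := by
    let F' : LaxMnd.Hom (CObj T Y.toPosComp) (CObj T X.toPosComp) := F.unop
    -- The transpose of `F'` under the adjunction, x ↦ ev_x ∘ F', followed by the inverse of `j` at
    -- Y.
    let f : PosComp.Hom X.toPosComp (VObj Y.toPosComp) :=
      ((unitEv T X.toPosComp).comp (GMap F')).comp (jInv hT Y.toPosComp)
    let φ : ContDist X.toPosComp Y.toPosComp :=
      ⟨fun x y => y ∈ (f.toFun x).set, f, fun _ _ => Iff.rfl⟩
    refine ⟨φ, Quiver.Hom.unop_inj (LaxMnd.Hom.ext (funext fun ψ : CSet Y.toPosComp =>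
      CSet.ext_val fun x => ?_))⟩
    -- The supremum of ψ over the support of ev_x ∘ F' is F'(ψ)(x).
    exact (GSet.app_eq_iSup_support ((GMap F').toFun ((unitEv T X.toPosComp).toFun x)) hT ψ).symm

end PosCompDuality

theorem mainTheorem2 (T : PosCompDuality.ContTNorm)
    (hT : T = PosCompDuality.mulTNorm ∨ T = PosCompDuality.lukTNorm) :
    CategoryTheory.IsIso (PosCompDuality.j.{u} T) ∧
      (PosCompDuality.CDist.{u} T).Full ∧ (PosCompDuality.CDist.{u} T).Faithful := by
  have hT' : T.IsArchimedean := by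
    rcases hT with rfl | rfl
    · exact PosCompDuality.mulTNorm_isArchimedean
    · exact PosCompDuality.lukTNorm_isArchimedean
  exact ⟨PosCompDuality.isIso_j hT', PosCompDuality.CDist_full hT',
    PosCompDuality.CDist_faithful hT'⟩
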